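/- Let $n\ge 1$, let $P$ be a probability distribution on $\mathcal X\times[0,1]$, let $(X_1,Y_1),\dots,(X_n,Y_n)\overset{iid}{\sim}P$, and let $f:\mathcal X\to[0,1]$ be a fixed measurable function. For a measurable $g:\mathcal X\to[0,1]$ define $$\Delta^P_{\mathrm{Cutoff}}(g)=\sup_{I\ \mathrm{interval}}\bigl|\mathbb E_P[(Y-g(X))\mathbf 1\{g(X)\in I\}]\bigr|,\qquad \widehat\Delta_{\mathrm{Cutoff}}(g)=\sup_{I\ \mathrm{interval}}\Bigl|\frac1n\sum_{i=1}^n (Y_i-g(X_i))\mathbf 1\{g(X_i)\in I\}\Bigr|,$$ where for a data-dependent $g$ the expectation $\mathbb E_P$ is taken over an independent draw $(X,Y)\sim P$ with $g$ held fixed. Let $\tilde h_n$ be a Platt-scaling fit, i.e. $\tilde h_n(z)=\sigma(az+b)$ with $\sigma(u)=1/(1+e^{-u})$, where $(a,b)\in\mathbb R^2$ minimizes the logistic loss $$-\sum_{i=1}^n\bigl[T_i\log\sigma(af(X_i)+b)+(1-T_i)\log(1-\sigma(af(X_i)+b))\bigr],$$ the targets being either $T_i=Y_i$ (when a minimizer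 exists) or the finite-sample targets $T_i=Y_i\frac{\sum_j Y_j+1}{\sum_j Y_j+2}+(1-Y_i)\frac{1}{\sum_j(1-Y_j)+2}$; any choice among minimizers is allowed. For a fixed $\epsilon_n>0$ define modified Platt scaling by $$h_n(z)=\begin{cases}\tilde h_n(z) & \text{if }\widehat\Delta_{\mathrm{Cutoff}}(\tilde h_n\circ f)\le\epsilon_n,\\ \frac1n\sum_{i=1}^nY_i&\text{otherwise.}\end{cases}$$ Let $\delta>0$ (with the convention that $\sqrt{x}=0$ for $x<0$, which is relevant only in the trivial case $\delta>2$). Then, with probability at least $1-\delta$, $$\Delta^P_{\mathrm{Cutoff}}(h_n\circ f)\le\frac{30+2\sqrt{2\log(2/\delta)}}{\sqrt n}+\epsilon_n .$$ -/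

import Mathlib

open MeasureTheory ProbabilityTheory

/-- Cutoff Calibration Error `sup_I |E_P[(Y - g(X)) 1{g(X) ∈ I}]|` of a forecast `g` under the
distribution `P` of `(X, Y)`; the intervals of `ℝ` (open, closed, half-open, degenerate, unbounded)
are exactly its order-connected subsets. The forecast is treated as fixed: the expectation is over
`P` only, also when `g` was itself fitted to data. -/
noncomputable def cutoffError {𝒳 : Type*} [MeasurableSpace 𝒳] (P : Measure (𝒳 × ℝ))
    (g : 𝒳 → ℝ) : ℝ :=
  ⨆ I : {I : Set ℝ // I.OrdConnected},
    |∫ p, (p.2 - g p.1) * I.1.indicator (fun _ => (1 : ℝ)) (g p.1) ∂P|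

/-- Plug-in estimator of the Cutoff Calibration Error on the data set `D = ((X_i, Y_i))_i`. -/
noncomputable def empiricalCutoffError {𝒳 : Type*} {n : ℕ} (D : Fin n → 𝒳 × ℝ)
    (g : 𝒳 → ℝ) : ℝ :=
  ⨆ I : {I : Set ℝ // I.OrdConnected},
    |(1 / (n : ℝ)) *
      ∑ i, ((D i).2 - g (D i).1) * I.1.indicator (fun _ => (1 : ℝ)) (g (D i).1)|

/-- Logistic loss (cross-entropy) of the model `z ↦ sigmoid (a * z + b)` on inputs `z_i` with
targets `t_i`. -/
noncomputable def logisticLoss {n : ℕ} (z t : Fin n → ℝ) (a b : ℝ) : ℝ :=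
  ∑ i, -(t i * Real.log (Real.sigmoid (a * z i + b)) +
    (1 - t i) * Real.log (1 - Real.sigmoid (a * z i + b)))

/-- Platt's smoothed targets
`Y_i (∑ Y_j + 1) / (∑ Y_j + 2) + (1 - Y_i) / (∑ (1 - Y_j) + 2)`. -/
noncomputable def plattTargets {n : ℕ} (y : Fin n → ℝ) : Fin n → ℝ := fun i =>
  y i * ((∑ j, y j + 1) / (∑ j, y j + 2)) + (1 - y i) * (1 / (∑ j, (1 - y j) + 2))

/-- `h` is the result of a univariate logistic regression of the targets `t_i` on the inputs `z_i`:
a logistic curve (with intercept) whose parameters minimize the logistic loss. -/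
def IsLogisticFit {n : ℕ} (z t : Fin n → ℝ) (h : ℝ → ℝ) : Prop :=
  ∃ a b : ℝ, (∀ a' b' : ℝ, logisticLoss z t a b ≤ logisticLoss z t a' b') ∧
    h = fun s => Real.sigmoid (a * s + b)

/-- `h` is a Platt-scaling fit to forecasts `z_i` and outcomes `y_i`: a logistic regression fit of
either the outcomes themselves or Platt's finite-sample targets. With the latter (and outcomes in
`[0, 1]`) a fit always exists; it is not unique when all `z_i` coincide. -/
def IsPlattFit {n : ℕ} (z y : Fin n → ℝ) (h : ℝ → ℝ) : Prop :=
  IsLogisticFit z y h ∨ IsLogisticFit z (plattTargets y) h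

/-- Modified Platt scaling: keep the Platt fit `hTilde` if the empirical Cutoff Calibration Error of
`hTilde ∘ f` is at most `ε`, otherwise return the constant empirical mean of `Y`. -/
noncomputable def modifiedPlatt {𝒳 : Type*} {n : ℕ} (D : Fin n → 𝒳 × ℝ) (f : 𝒳 → ℝ) (ε : ℝ)
    (hTilde : ℝ → ℝ) : ℝ → ℝ := fun z =>
  if empiricalCutoffError D (hTilde ∘ f) ≤ ε then hTilde z else (1 / (n : ℝ)) * ∑ i, (D i).2

/-! The fit is data-dependent, but it enters only as a monotone map `h` with values in `[0, 1]`.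
Hence `{h ∘ f ∈ I}` is `{f ∈ J}` with `J = h ⁻¹' I` again an interval, and the population and
empirical cutoff sums differ by the empirical error of `Y 1{f ∈ J}` minus that of `h(f) 1{f ∈ J}`.
By the layer-cake formula the second function is a uniform limit of averages of indicators `1{f ∈
J'}`, `J'` an interval. So it suffices to control two fixed classes, half-lines in `f` weighted by
`Y` and by `1`; an interval is a difference of two lower sets, which costs a factor 2
(`abs_empiricalError_ordConnected_le`, `abs_empiricalError_monotone_comp_le`).

For either class, symmetrization (`integral_uniformDeviation_le`) reduces the expected supremum to a
Rademacher average. After sorting by `f`, half-line sums are partial sums of one signed sum, so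
Doob's maximal inequality bounds them by order `√n` without a logarithm. This gives `2√8/√n` per
class, at most `15/√n` for both, and McDiarmid's inequality adds the deviation term. Doubling gives
the stated constants.

If the fit is kept, its empirical error is at most `ε`. If it is replaced by the mean of `Y`, the
error is at most the deviation of that mean, which the first class already controls. -/

/-! ### Rademacher sums over half-lines. -/

/-- The Rademacher sign encoded by a Boolean. -/
def rademacherSign (b : Bool) : ℝ := if b then 1 else -1

lemma rademacherSign_not (b : Bool) : rademacherSign (!b) = -rademacherSign b := by
  cases b <;> simp [rademacherSign]

lemma abs_rademacherSign (b : Bool) : |rademacherSign b| = 1 := by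
  cases b <;> simp [rademacherSign]

lemma rademacherSign_sq (b : Bool) : rademacherSign b ^ 2 = 1 := by
  cases b <;> simp [rademacherSign]

/-- A function of the signs that ignores the `i`-th one is orthogonal to the `i`-th sign. -/
lemma sum_mul_rademacherSign_eq_zero {ι : Type*} [Fintype ι] [DecidableEq ι]
    (W : (ι → Bool) → ℝ) (i : ι) (hW : ∀ σ b, W (Function.update σ i b) = W σ) :
    ∑ σ, W σ * rademacherSign (σ i) = 0 := by
  have hinv : Function.Involutive (fun σ : ι → Bool => Function.update σ i (!σ i)) := by
    intro σ; simp
  have h := Equiv.sum_comp hinv.toPerm (fun σ => W σ * rademacherSign (σ i))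
  simp only [Function.Involutive.coe_toPerm, hW, Function.update_self, rademacherSign_not,
    mul_neg, Finset.sum_neg_distrib] at h
  linarith

lemma sum_sq_rademacher_sum {ι : Type*} [Fintype ι] [DecidableEq ι] (y : ι → ℝ) (s : Finset ι) :
    ∑ σ : ι → Bool, (∑ i ∈ s, rademacherSign (σ i) * y i) ^ 2 =
      2 ^ Fintype.card ι * ∑ i ∈ s, y i ^ 2 := by
  induction s using Finset.induction_on with
  | empty => simp
  | insert a s ha ih =>
    have h0 := sum_mul_rademacherSign_eq_zero
      (fun σ : ι → Bool => ∑ i ∈ s, rademacherSign (σ i) * y i) a (by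
        intro σ b
        refine Finset.sum_congr rfl fun i hi => ?_
        rw [Function.update_of_ne (by rintro rfl; exact ha hi)])
    have : ∀ σ : ι → Bool, (∑ i ∈ insert a s, rademacherSign (σ i) * y i) ^ 2 =
        y a ^ 2 + 2 * y a * ((∑ i ∈ s, rademacherSign (σ i) * y i) * rademacherSign (σ a)) +
          (∑ i ∈ s, rademacherSign (σ i) * y i) ^ 2 := by
      intro σ
      rw [Finset.sum_insert ha]
      linear_combination y a ^ 2 * rademacherSign_sq (σ a)
    simp_rw [this, Finset.sum_add_distrib, ← Finset.mul_sum, h0, ih, Finset.sum_insert ha]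
    simp [mul_add]

/-- Doob's maximal inequality for the partial sums of a Rademacher sum, in product form. -/
lemma exists_rademacher_partialSum_bound {ι : Type*} [Fintype ι] [DecidableEq ι] (z y : ι → ℝ)
    (s : Finset ι) :
    ∃ W : (ι → Bool) → ℝ, (∀ σ, 0 ≤ W σ) ∧
      (∀ i ∉ s, ∀ σ b, W (Function.update σ i b) = W σ) ∧
      (∀ σ t, ∑ i ∈ s with z i ≤ t, rademacherSign (σ i) * y i ≤ W σ) ∧
      ∑ σ, (W σ ^ 2 - 2 * (W σ * ∑ i ∈ s, rademacherSign (σ i) * y i)) ≤ 0 := by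
  induction s using Finset.induction_on_max_value z with
  | empty => exact ⟨fun _ => 0, by simp, by simp, by simp, by simp⟩
  | insert a s ha hmax ih =>
    obtain ⟨W, hW0, hWs, hWt, hW⟩ := ih
    -- Points enter in increasing order of `z`, so a half-line containing the new point contains all
    -- points: its sum is the full sum, and every other sum is an old one.
    refine ⟨fun σ => max (W σ) (∑ i ∈ insert a s, rademacherSign (σ i) * y i),
      fun σ => le_max_of_le_left (hW0 σ), ?_, ?_, ?_⟩
    · intro i hi σ b
      rw [Finset.mem_insert, not_or] at hi
      dsimp only
      rw [hWs i hi.2 σ b]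
      congr 1
      refine Finset.sum_congr rfl fun j hj => ?_
      rw [Function.update_of_ne]
      rintro rfl
      rcases Finset.mem_insert.1 hj with h | h
      exacts [hi.1 h, hi.2 h]
    · intro σ t
      by_cases ht : z a ≤ t
      · rw [Finset.filter_true_of_mem]
        · exact le_max_right _ _
        · intro i hi
          rcases Finset.mem_insert.1 hi with rfl | h
          exacts [ht, (hmax i h).trans ht]
      · rw [Finset.filter_insert, if_neg ht]
        exact (hWt σ t).trans (le_max_left _ _)
    -- The old maximum ignores the new sign, so the cross term averages to zero. Pointwise, with new
    -- sum `S'`, equality holds if the maximum stays `W`; if it becomes `S'`, use `-S'² ≤ W² - 2 W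
    -- S'`.
    · have h0 := sum_mul_rademacherSign_eq_zero W a (hWs a ha)
      calc _ ≤ ∑ σ, ((W σ ^ 2 - 2 * (W σ * ∑ i ∈ s, rademacherSign (σ i) * y i)) -
              2 * y a * (W σ * rademacherSign (σ a))) := by
            refine Finset.sum_le_sum fun σ _ => ?_
            simp only [Finset.sum_insert ha]
            set S := ∑ i ∈ s, rademacherSign (σ i) * y i
            rcases max_cases (W σ) (rademacherSign (σ a) * y a + S) with h | h <;> rw [h.1]
            · nlinarith
            · nlinarith [sq_nonneg (W σ - (rademacherSign (σ a) * y a + S))]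
        _ ≤ 0 := by
            rw [Finset.sum_sub_distrib, ← Finset.mul_sum, h0]
            linarith

lemma exists_rademacher_partialSum_sq_bound {ι : Type*} [Fintype ι] [DecidableEq ι]
    (z y : ι → ℝ) :
    ∃ W : (ι → Bool) → ℝ, (∀ σ, 0 ≤ W σ) ∧
      (∀ σ t, ∑ i with z i ≤ t, rademacherSign (σ i) * y i ≤ W σ) ∧
      ∑ σ, W σ ^ 2 ≤ 4 * (2 ^ Fintype.card ι * ∑ i, y i ^ 2) := by
  obtain ⟨W, hW0, -, hWt, hW⟩ := exists_rademacher_partialSum_bound z y Finset.univ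
  refine ⟨W, hW0, hWt, ?_⟩
  rw [← sum_sq_rademacher_sum y Finset.univ, Finset.mul_sum]
  -- This is `(W - 2S)² ≥ 0`; it replaces the usual Cauchy–Schwarz step of Doob's inequality.
  have : ∀ σ : ι → Bool, W σ ^ 2 - 4 * (∑ i, rademacherSign (σ i) * y i) ^ 2 ≤
      2 * (W σ ^ 2 - 2 * (W σ * ∑ i, rademacherSign (σ i) * y i)) := fun σ => by
    nlinarith [sq_nonneg (W σ - 2 * ∑ i, rademacherSign (σ i) * y i)]
  have h := Finset.sum_le_sum fun σ (_ : σ ∈ Finset.univ) => this σ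
  rw [← Finset.mul_sum, Finset.sum_sub_distrib] at h
  linarith

/-- The Rademacher complexity of weighted half-lines. -/
lemma sum_iSup_rademacher_halfLine_le {T : Type*} [Nonempty T] {n : ℕ} (τ : T → ℝ)
    (z y : Fin n → ℝ) (hy : ∀ i, |y i| ≤ 1) :
    ∑ σ : Fin n → Bool,
      ⨆ q : T, |∑ i, rademacherSign (σ i) * (y i * (Set.Iic (τ q)).indicator (fun _ => (1 : ℝ)) (z i))| ≤
      2 ^ n * √(8 * n) := by
  obtain ⟨W, hW0, hWt, hW⟩ := exists_rademacher_partialSum_sq_bound z y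
  obtain ⟨V, hV0, hVt, hV⟩ := exists_rademacher_partialSum_sq_bound z (-y)
  have hy2 : ∑ i, y i ^ 2 ≤ n := by
    calc _ ≤ ∑ _i : Fin n, (1 : ℝ) := Finset.sum_le_sum fun i _ => by
          rw [← sq_abs]; exact pow_le_one₀ (abs_nonneg _) (hy i)
      _ = n := by simp
  simp only [Pi.neg_apply, neg_sq, mul_neg, Finset.sum_neg_distrib, Fintype.card_fin] at hV hVt hW
  -- `V` handles the lower tail. The Euclidean combination matters: `W + V` would only give `√(16
  -- n)`, and the final constant 15 would become 16.
  have key : ∀ σ : Fin n → Bool,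
      ⨆ q : T, |∑ i, rademacherSign (σ i) * (y i * (Set.Iic (τ q)).indicator (fun _ => (1 : ℝ)) (z i))| ≤
        √(W σ ^ 2 + V σ ^ 2) := by
    intro σ
    refine ciSup_le fun q => ?_
    have : ∑ i, rademacherSign (σ i) * (y i * (Set.Iic (τ q)).indicator (fun _ => (1 : ℝ)) (z i)) =
        ∑ i with z i ≤ τ q, rademacherSign (σ i) * y i := by
      rw [Finset.sum_filter]
      refine Finset.sum_congr rfl fun i _ => ?_
      by_cases h : z i ≤ τ q <;> simp [h]
    rw [this]
    refine abs_le.2 ⟨?_, (hWt σ _).trans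
      (Real.le_sqrt_of_sq_le (le_add_of_nonneg_right (sq_nonneg _)))⟩
    have h1 := hVt σ (τ q)
    have h2 : V σ ≤ √(W σ ^ 2 + V σ ^ 2) :=
      Real.le_sqrt_of_sq_le (le_add_of_nonneg_left (sq_nonneg _))
    linarith
  refine (Finset.sum_le_sum fun σ _ => key σ).trans ?_
  have hcs := sq_sum_le_card_mul_sum_sq (s := (Finset.univ : Finset (Fin n → Bool)))
    (f := fun σ => √(W σ ^ 2 + V σ ^ 2))
  have hsq : ∀ σ, √(W σ ^ 2 + V σ ^ 2) ^ 2 = W σ ^ 2 + V σ ^ 2 := fun σ =>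
    Real.sq_sqrt (by positivity)
  simp only [hsq, Finset.sum_add_distrib, Finset.card_univ, Fintype.card_pi, Fintype.card_bool,
    Finset.prod_const, Fintype.card_fin, Nat.cast_pow, Nat.cast_ofNat] at hcs
  refine abs_le_of_sq_le_sq' ?_ (by positivity) |>.2
  rw [mul_pow, Real.sq_sqrt (by positivity)]
  have h2n : (0 : ℝ) < 2 ^ n := by positivity
  calc _ ≤ _ := hcs
    _ ≤ (2 : ℝ) ^ n * (2 * (4 * (2 ^ n * n))) := by
      have := mul_le_mul_of_nonneg_left hy2 h2n.le
      gcongr; linarith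
    _ = _ := by ring

/-! ### McDiarmid's inequality. -/

lemma integral_pi_succ {Z : Type*} [MeasurableSpace Z] (P : Measure Z) [IsProbabilityMeasure P]
    {n : ℕ} (F : (Fin (n + 1) → Z) → ℝ) (hF : Measurable F) {C : ℝ} (hC : ∀ x, |F x| ≤ C) :
    ∫ x, F x ∂(Measure.pi fun _ => P) =
      ∫ x, ∫ r, F (Fin.cons x r) ∂(Measure.pi fun _ => P) ∂P := by
  have hmp := (measurePreserving_piFinSuccAbove (fun _ : Fin (n + 1) => P) 0).symm
  have hcons : ∀ p : Z × (Fin n → Z),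
      (MeasurableEquiv.piFinSuccAbove (fun _ : Fin (n + 1) => Z) 0).symm p = Fin.cons p.1 p.2 := by
    intro p
    simp [MeasurableEquiv.piFinSuccAbove, Fin.insertNthEquiv]
  rw [← hmp.integral_comp']
  simp_rw [hcons]
  rw [integral_prod]
  refine Integrable.of_bound (C := C) ?_ (ae_of_all _ fun p => hC _)
  simp_rw [← hcons]
  exact (hF.comp (MeasurableEquiv.measurable _)).aestronglyMeasurable

lemma measurable_finCons {Z : Type*} [MeasurableSpace Z] {n : ℕ} :
    Measurable fun p : Z × (Fin n → Z) => (Fin.cons p.1 p.2 : Fin (n + 1) → Z) := by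
  refine measurable_pi_lambda _ fun i => ?_
  refine Fin.cases ?_ (fun j => ?_) i
  · simpa using measurable_fst
  · simp only [Fin.cons_succ]
    fun_prop

/-- Moment generating function bound behind **McDiarmid's inequality**. -/
lemma integral_exp_pi_le_of_bounded_differences {Z : Type*} [MeasurableSpace Z] (P : Measure Z)
    [IsProbabilityMeasure P] {c : ℝ} (t : ℝ) :
    ∀ (n : ℕ) (F : (Fin n → Z) → ℝ), Measurable F → (∃ C, ∀ x, |F x| ≤ C) →
      (∀ x i v, F (Function.update x i v) - F x ≤ c) →
      ∫ x, Real.exp (t * F x) ∂(Measure.pi fun _ => P) ≤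
        Real.exp (t * ∫ x, F x ∂(Measure.pi fun _ => P) + n * ((c / 2) ^ 2 * t ^ 2 / 2)) := by
  intro n
  induction n with
  | zero =>
    intro F hF _ _
    have h : ∀ x, F x = F default := fun x => congrArg F (Subsingleton.elim _ _)
    simp only [h]
    simp
  | succ n ih =>
    rintro F hF ⟨C, hC⟩ hd
    have hne : Nonempty Z := nonempty_of_isProbabilityMeasure P
    have hexpC : ∀ x, |Real.exp (t * F x)| ≤ Real.exp (|t| * C) := fun x => by
      rw [Real.abs_exp, Real.exp_le_exp]
      calc t * F x ≤ |t * F x| := le_abs_self _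
        _ ≤ |t| * C := by rw [abs_mul]; gcongr; exact hC x
    have hFm : ∀ x, Measurable fun r : Fin n → Z => F (Fin.cons x r) := fun x =>
      hF.comp (measurable_finCons.comp measurable_prodMk_left)
    have hFi : ∀ x, Integrable (fun r : Fin n → Z => F (Fin.cons x r))
        (Measure.pi fun _ => P) := fun x =>
      Integrable.of_bound (hFm x).aestronglyMeasurable C (ae_of_all _ fun r => hC _)
    -- Averaging out all coordinates but the first leaves a function of one variable that still
    -- varies by at most `c`.
    set G : Z → ℝ := fun x => ∫ r, F (Fin.cons x r) ∂(Measure.pi fun _ => P) with hG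
    have hGm : Measurable G :=
      (StronglyMeasurable.integral_prod_right
        (f := fun x (r : Fin n → Z) => F (Fin.cons x r))
        (hF.comp measurable_finCons).stronglyMeasurable).measurable
    have hGd : ∀ x x', G x' ≤ G x + c := by
      intro x x'
      have : G x' ≤ ∫ r, (F (Fin.cons x r) + c) ∂(Measure.pi fun _ : Fin n => P) := by
        refine integral_mono (hFi x') ((hFi x).add (integrable_const c)) fun r => ?_
        have := hd (Fin.cons x r) 0 x'
        rw [Fin.update_cons_zero] at this
        dsimp only
        linarith
      rwa [integral_add (hFi x) (integrable_const c), integral_const, probReal_univ,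
        one_smul] at this
    have hbb : BddBelow (Set.range G) := by
      refine ⟨G hne.some - c, ?_⟩
      rintro _ ⟨x, rfl⟩
      linarith [hGd x hne.some]
    -- The one-sided bound holds for every ordered pair, which confines `G` to an interval of length
    -- `c`; Hoeffding's lemma then gives variance proxy `(c / 2)²`.
    have hGI : ∀ x, G x ∈ Set.Icc (⨅ x, G x) ((⨅ x, G x) + c) := fun x =>
      ⟨ciInf_le hbb x, by
        rw [← sub_le_iff_le_add]
        exact le_ciInf fun x' => by linarith [hGd x' x]⟩
    have hgauss := (hasSubgaussianMGF_of_mem_Icc hGm.aemeasurable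
      (ae_of_all P hGI)).mgf_le t
    have hGexp : Integrable (fun x => Real.exp (t * G x)) P :=
      integrable_exp_mul_of_mem_Icc hGm.aemeasurable (ae_of_all P hGI)
    rw [integral_pi_succ P _ (by fun_prop) hexpC, integral_pi_succ P F hF hC]
    set κ := (c / 2) ^ 2 * t ^ 2 / 2
    calc ∫ x, ∫ r, Real.exp (t * F (Fin.cons x r)) ∂(Measure.pi fun _ => P) ∂P
        ≤ ∫ x, Real.exp (t * G x) * Real.exp (n * κ) ∂P := by
          refine integral_mono_of_nonneg (ae_of_all _ fun x => ?_) (hGexp.mul_const _)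
            (ae_of_all _ fun x => ?_)
          · exact integral_nonneg fun r => (Real.exp_pos _).le
          · dsimp only
            rw [← Real.exp_add]
            refine ih (fun r => F (Fin.cons x r)) (hFm x) ⟨C, fun r => hC _⟩ fun r i v => ?_
            rw [Fin.cons_update]
            exact hd _ _ _
      _ = Real.exp (n * κ) * (Real.exp (t * ∫ x, G x ∂P) *
            mgf (fun x => G x - ∫ x, G x ∂P) P t) := by
          have hsplit : ∀ x, Real.exp (t * G x) =
              Real.exp (t * ∫ x, G x ∂P) * Real.exp (t * (G x - ∫ x, G x ∂P)) := fun x => by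
            rw [← Real.exp_add]
            ring_nf
          rw [integral_mul_const, mul_comm, mgf,
            ← integral_const_mul (Real.exp (t * ∫ x, G x ∂P))]
          exact congrArg _ (integral_congr_ae (ae_of_all _ hsplit))
      _ ≤ Real.exp (n * κ) * (Real.exp (t * ∫ x, G x ∂P) * Real.exp κ) := by
          gcongr
          refine hgauss.trans_eq ?_
          simp [κ, div_pow]
      _ = _ := by
          rw [← Real.exp_add, ← Real.exp_add, hG]
          congr 1
          push_cast
          ring

/-- **McDiarmid's inequality** for i.i.d. coordinates. -/
lemma measureReal_pi_ge_le_of_bounded_differences {Z : Type*} [MeasurableSpace Z] (P : Measure Z)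
    [IsProbabilityMeasure P] {c : ℝ} (hc : 0 < c) {n : ℕ} (hn : 0 < n) (F : (Fin n → Z) → ℝ)
    (hF : Measurable F) {C : ℝ} (hC : ∀ x, |F x| ≤ C)
    (hd : ∀ x i v, F (Function.update x i v) - F x ≤ c) {s : ℝ} (hs : 0 ≤ s) :
    (Measure.pi fun _ => P).real {x | (∫ x, F x ∂(Measure.pi fun _ => P)) + s ≤ F x} ≤
      Real.exp (-(2 * s ^ 2 / (n * c ^ 2))) := by
  set m := ∫ x, F x ∂(Measure.pi fun _ => P)
  -- The minimizer of the Chernoff exponent `-t s + n c² t² / 8`.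
  set t := 4 * s / (n * c ^ 2) with ht
  have hn' : (0 : ℝ) < n := by exact_mod_cast hn
  have ht0 : 0 ≤ t := by positivity
  have hint : Integrable (fun x => Real.exp (t * F x)) (Measure.pi fun _ => P) :=
    integrable_exp_mul_of_mem_Icc hF.aemeasurable (a := -C) (b := C)
      (ae_of_all _ fun x => abs_le.1 (hC x))
  refine (measure_ge_le_exp_mul_mgf (m + s) ht0 hint).trans ?_
  have h := integral_exp_pi_le_of_bounded_differences P t n F hF ⟨C, hC⟩ hd
  calc _ ≤ Real.exp (-t * (m + s)) * Real.exp (t * m + n * ((c / 2) ^ 2 * t ^ 2 / 2)) := by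
        gcongr; exact h
    _ = _ := by
        rw [← Real.exp_add]
        congr 1
        rw [ht]
        field_simp
        ring

/-! ### Uniform deviations and symmetrization. -/

/-- Uniform deviation between empirical means and expectations over the class `φ`. -/
noncomputable def uniformDeviation {Z T : Type*} [MeasurableSpace Z] (P : Measure Z)
    (φ : T → Z → ℝ) {n : ℕ} (z : Fin n → Z) : ℝ :=
  ⨆ t, |(1 / (n : ℝ)) * ∑ i, φ t (z i) - ∫ x, φ t x ∂P|

section uniformDeviation

variable {Z T : Type*} [MeasurableSpace Z] {P : Measure Z} {φ : T → Z → ℝ} {n : ℕ}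

lemma uniformDeviation_nonneg (z : Fin n → Z) : 0 ≤ uniformDeviation P φ z :=
  Real.iSup_nonneg fun _ => abs_nonneg _

lemma measurable_uniformDeviation [Countable T] (hφm : ∀ t, Measurable (φ t)) :
    Measurable fun z : Fin n → Z => uniformDeviation P φ z := by
  refine Measurable.iSup fun t => ?_
  have := hφm t
  fun_prop

variable [IsProbabilityMeasure P]

lemma abs_empiricalMean_sub_integral_le (hφm : ∀ t, Measurable (φ t))
    (hφ : ∀ t x, φ t x ∈ Set.Icc (0 : ℝ) 1) (z : Fin n → Z) (t : T) :
    |(1 / (n : ℝ)) * ∑ i, φ t (z i) - ∫ x, φ t x ∂P| ≤ 1 := by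
  have h1 : ∫ x, φ t x ∂P ∈ Set.Icc (0 : ℝ) 1 := by
    refine ⟨integral_nonneg fun x => (hφ t x).1, ?_⟩
    have : ∫ x, φ t x ∂P ≤ ∫ _x, (1 : ℝ) ∂P :=
      integral_mono (Integrable.of_bound (hφm t).aestronglyMeasurable 1 (ae_of_all _ fun x =>
        (abs_of_nonneg (hφ t x).1).trans_le (hφ t x).2)) (integrable_const _)
        fun x => (hφ t x).2
    simpa using this
  have h2 : (1 / (n : ℝ)) * ∑ i, φ t (z i) ∈ Set.Icc (0 : ℝ) 1 := by
    refine ⟨mul_nonneg (by positivity) (Finset.sum_nonneg fun i _ => (hφ t _).1), ?_⟩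
    have : ∑ i, φ t (z i) ≤ ∑ _i : Fin n, (1 : ℝ) := Finset.sum_le_sum fun i _ => (hφ t _).2
    rw [one_div_mul_eq_div]
    exact div_le_one_of_le₀ (by simpa using this) n.cast_nonneg
  exact abs_le.2 ⟨by linarith [h1.2, h2.1], by linarith [h1.1, h2.2]⟩

lemma bddAbove_range_empiricalMean_sub_integral (hφm : ∀ t, Measurable (φ t))
    (hφ : ∀ t x, φ t x ∈ Set.Icc (0 : ℝ) 1) (z : Fin n → Z) :
    BddAbove (Set.range fun t => |(1 / (n : ℝ)) * ∑ i, φ t (z i) - ∫ x, φ t x ∂P|) :=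
  ⟨1, by rintro _ ⟨t, rfl⟩; exact abs_empiricalMean_sub_integral_le hφm hφ z t⟩

lemma le_uniformDeviation (hφm : ∀ t, Measurable (φ t))
    (hφ : ∀ t x, φ t x ∈ Set.Icc (0 : ℝ) 1) (z : Fin n → Z) (t : T) :
    |(1 / (n : ℝ)) * ∑ i, φ t (z i) - ∫ x, φ t x ∂P| ≤ uniformDeviation P φ z :=
  le_ciSup (bddAbove_range_empiricalMean_sub_integral hφm hφ z) t

lemma uniformDeviation_le_one (hφm : ∀ t, Measurable (φ t))
    (hφ : ∀ t x, φ t x ∈ Set.Icc (0 : ℝ) 1) (z : Fin n → Z) : uniformDeviation P φ z ≤ 1 :=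
  Real.iSup_le (abs_empiricalMean_sub_integral_le hφm hφ z) zero_le_one

lemma uniformDeviation_update_sub_le [Nonempty T] (hφm : ∀ t, Measurable (φ t))
    (hφ : ∀ t x, φ t x ∈ Set.Icc (0 : ℝ) 1) (z : Fin n → Z) (i : Fin n) (v : Z) :
    uniformDeviation P φ (Function.update z i v) - uniformDeviation P φ z ≤ 1 / n := by
  rw [sub_le_iff_le_add]
  refine ciSup_le fun t => ?_
  have h := le_uniformDeviation (P := P) hφm hφ z t
  have hsum : ∑ j, φ t (Function.update z i v j) = ∑ j, φ t (z j) + (φ t v - φ t (z i)) := by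
    rw [← Finset.add_sum_erase _ _ (Finset.mem_univ i),
      ← Finset.add_sum_erase _ (fun j => φ t (z j)) (Finset.mem_univ i), Function.update_self,
      Finset.sum_congr rfl fun j hj => by rw [Function.update_of_ne (Finset.ne_of_mem_erase hj)]]
    ring
  have hd : |φ t v - φ t (z i)| ≤ 1 :=
    abs_le.2 ⟨by linarith [(hφ t v).1, (hφ t (z i)).2], by linarith [(hφ t v).2, (hφ t (z i)).1]⟩
  rw [hsum, mul_add, add_sub_right_comm]
  refine (abs_add_le _ _).trans ?_
  rw [abs_mul, abs_of_nonneg (by positivity : (0 : ℝ) ≤ 1 / n), add_comm]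
  gcongr
  exact mul_le_of_le_one_right (by positivity) hd

/-- Symmetrization: the expected uniform deviation is at most twice the Rademacher complexity. -/
lemma integral_uniformDeviation_le [Countable T] [Nonempty T] (hφm : ∀ t, Measurable (φ t))
    (hφ : ∀ t x, φ t x ∈ Set.Icc (0 : ℝ) 1) (hn : 0 < n) {R : ℝ}
    (hR : ∀ z : Fin n → Z,
      ∑ σ : Fin n → Bool, ⨆ t, |∑ i, rademacherSign (σ i) * φ t (z i)| ≤ 2 ^ n * R) :
    ∫ z, uniformDeviation P φ z ∂(Measure.pi fun _ : Fin n => P) ≤ 2 * R / n := by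
  have hn' : (0 : ℝ) < n := by exact_mod_cast hn
  have hφa : ∀ t x, |φ t x| ≤ 1 := fun t x => (abs_of_nonneg (hφ t x).1).trans_le (hφ t x).2
  have hbound : ∀ (w : Fin n → Z × Z) t,
      |(1 / (n : ℝ)) * ∑ i, (φ t (w i).1 - φ t (w i).2)| ≤ 1 := by
    intro w t
    rw [abs_mul, abs_of_nonneg (by positivity : (0 : ℝ) ≤ 1 / n), one_div_mul_eq_div,
      div_le_one hn']
    refine (Finset.abs_sum_le_sum_abs _ _).trans ?_
    calc _ ≤ ∑ _i : Fin n, (1 : ℝ) := Finset.sum_le_sum fun i _ =>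
          abs_le.2 ⟨by linarith [(hφ t (w i).1).1, (hφ t (w i).2).2],
            by linarith [(hφ t (w i).1).2, (hφ t (w i).2).1]⟩
      _ = n := by simp
  set H : (Fin n → Z × Z) → ℝ := fun w => ⨆ t, |(1 / (n : ℝ)) * ∑ i, (φ t (w i).1 - φ t (w i).2)|
  have hHb : ∀ w : Fin n → Z × Z, BddAbove (Set.range fun t =>
      |(1 / (n : ℝ)) * ∑ i, (φ t (w i).1 - φ t (w i).2)|) := fun w =>
    ⟨1, by rintro _ ⟨t, rfl⟩; exact hbound w t⟩
  have hHm : Measurable H := by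
    refine Measurable.iSup fun t => ?_
    have := hφm t
    fun_prop
  have hH1 : ∀ w, ‖H w‖ ≤ 1 := fun w => by
    rw [Real.norm_eq_abs, abs_of_nonneg (Real.iSup_nonneg fun _ => abs_nonneg _)]
    exact ciSup_le (hbound w)
  set π := Measure.pi fun _ : Fin n => P
  set π2 := Measure.pi fun _ : Fin n => P.prod P
  have hHi : Integrable H π2 := Integrable.of_bound hHm.aestronglyMeasurable 1 (ae_of_all _ hH1)
  set H2 : (Fin n → Z) × (Fin n → Z) → ℝ := fun p => H fun i => (p.1 i, p.2 i)
  have hH2m : Measurable H2 := hHm.comp (by fun_prop)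
  have hH2i : Integrable H2 (π.prod π) :=
    Integrable.of_bound hH2m.aestronglyMeasurable 1 (ae_of_all _ fun p => hH1 _)
  have hH2i' : ∀ z, Integrable (fun z' => H2 (z, z')) π := fun z =>
    Integrable.of_bound (hH2m.comp measurable_prodMk_left).aestronglyMeasurable 1
      (ae_of_all _ fun p => hH1 _)
  -- The expectation under `P` is an average over an independent ghost sample `z'`, and a supremum
  -- of averages is at most the average of suprema.
  have hghost : ∀ z, uniformDeviation P φ z ≤ ∫ z', H2 (z, z') ∂π := by
    intro z
    refine ciSup_le fun t => ?_
    have hev : ∀ i, Integrable (fun z' : Fin n → Z => φ t (z' i)) π := fun i =>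
      Integrable.of_bound ((hφm t).comp (measurable_pi_apply i)).aestronglyMeasurable 1
        (ae_of_all _ fun _ => hφa t _)
    have heval : ∀ i, ∫ z', φ t (z' i) ∂π = ∫ x, φ t x ∂P := fun i => by
      rw [← (measurePreserving_eval (fun _ : Fin n => P) i).map_eq,
        integral_map (measurable_pi_apply i).aemeasurable (hφm t).aestronglyMeasurable]
    have hsub : ∀ i, Integrable (fun z' : Fin n → Z => φ t (z i) - φ t (z' i)) π := fun i =>
      (integrable_const _).sub (hev i)
    have hint : Integrable (fun z' : Fin n → Z => (1 / (n : ℝ)) * ∑ i, (φ t (z i) - φ t (z' i))) π :=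
      (integrable_finsetSum _ fun i _ => hsub i).const_mul _
    have heq : (1 / (n : ℝ)) * ∑ i, φ t (z i) - ∫ x, φ t x ∂P =
        ∫ z', (1 / (n : ℝ)) * ∑ i, (φ t (z i) - φ t (z' i)) ∂π := by
      rw [integral_const_mul, integral_finsetSum _ fun i _ => hsub i]
      simp_rw [integral_sub (integrable_const _) (hev _), heval, Finset.sum_sub_distrib]
      simp only [integral_const, probReal_univ, one_smul, Finset.sum_const, Finset.card_univ,
        Fintype.card_fin, nsmul_eq_mul]
      field_simp
    rw [heq]
    exact (abs_integral_le_integral_abs).trans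
      (integral_mono hint.abs (hH2i' z) fun z' => le_ciSup (hHb fun i => (z i, z' i)) t)
  have hstep : ∫ z, uniformDeviation P φ z ∂π ≤ ∫ w, H w ∂π2 := by
    have hmp := measurePreserving_arrowProdEquivProdArrow Z Z (Fin n) (fun _ => P) (fun _ => P)
    calc _ ≤ ∫ z, ∫ z', H2 (z, z') ∂π ∂π :=
          integral_mono_of_nonneg (ae_of_all _ fun z => uniformDeviation_nonneg z)
            hH2i.integral_prod_left (ae_of_all _ hghost)
      _ = ∫ p, H2 p ∂(π.prod π) := (integral_prod _ hH2i).symm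
      _ = ∫ w, H w ∂π2 := (hmp.integral_comp' H2).symm
  set K : (Fin n → Bool) → (Fin n → Z) → ℝ := fun σ z =>
    ⨆ t, |∑ i, rademacherSign (σ i) * φ t (z i)|
  have hKb : ∀ (σ : Fin n → Bool) (z : Fin n → Z), BddAbove (Set.range fun t => |∑ i, rademacherSign (σ i) * φ t (z i)|) := by
    refine fun σ z => ⟨n, ?_⟩
    rintro _ ⟨t, rfl⟩
    refine (Finset.abs_sum_le_sum_abs _ _).trans ?_
    calc _ ≤ ∑ _i : Fin n, (1 : ℝ) := Finset.sum_le_sum fun i _ => by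
          rw [abs_mul, abs_rademacherSign, one_mul]; exact hφa t _
      _ = n := by simp
  -- Exchanging the members of a pair preserves the law, so `H` may be averaged over all `2 ^ n`
  -- exchanges; these put Rademacher signs on the differences.
  set sw : (Fin n → Bool) → (Fin n → Z × Z) → (Fin n → Z × Z) := fun σ w i =>
    if σ i then w i else (w i).swap with hsw
  have hswmp : ∀ σ, MeasurePreserving (sw σ) π2 π2 := fun σ => by
    refine measurePreserving_pi (f := fun i (p : Z × Z) => if σ i then p else p.swap)
      (fun _ => P.prod P) (fun _ => P.prod P) fun i => ?_
    cases σ i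
    · simpa using Measure.measurePreserving_swap
    · simpa using! MeasurePreserving.id (P.prod P)
  have hswle : ∀ σ w, H (sw σ w) ≤
      (1 / (n : ℝ)) * (K σ (fun i => (w i).1) + K σ (fun i => (w i).2)) := by
    intro σ w
    refine ciSup_le fun t => ?_
    have : ∑ i, (φ t (sw σ w i).1 - φ t (sw σ w i).2) =
        ∑ i, rademacherSign (σ i) * φ t (w i).1 - ∑ i, rademacherSign (σ i) * φ t (w i).2 := by
      rw [← Finset.sum_sub_distrib]
      refine Finset.sum_congr rfl fun i _ => ?_
      cases h : σ i <;> simp [hsw, h, rademacherSign]; ring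
    rw [this, abs_mul, abs_of_nonneg (by positivity : (0 : ℝ) ≤ 1 / n)]
    gcongr
    exact (abs_sub _ _).trans (add_le_add (le_ciSup (hKb σ _) t) (le_ciSup (hKb σ _) t))
  have hswi : ∀ σ, Integrable (fun w => H (sw σ w)) π2 := fun σ =>
    Integrable.of_bound (hHm.comp (hswmp σ).measurable).aestronglyMeasurable 1
      (ae_of_all _ fun w => hH1 _)
  have havg : (2 : ℝ) ^ n * ∫ w, H w ∂π2 = ∫ w, ∑ σ, H (sw σ w) ∂π2 := by
    rw [integral_finsetSum _ fun σ _ => hswi σ]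
    have : ∀ σ, ∫ w, H (sw σ w) ∂π2 = ∫ w, H w ∂π2 := fun σ => by
      conv_rhs => rw [← (hswmp σ).map_eq]
      rw [integral_map (hswmp σ).measurable.aemeasurable hHm.aestronglyMeasurable]
    simp [this]
  have hfin : (2 : ℝ) ^ n * ∫ w, H w ∂π2 ≤ 2 ^ n * (2 * R / n) := by
    rw [havg]
    have : ∀ w, ∑ σ, H (sw σ w) ≤ 2 ^ n * (2 * R / n) := fun w => by
      refine (Finset.sum_le_sum fun σ _ => hswle σ w).trans ?_
      rw [← Finset.mul_sum, Finset.sum_add_distrib, one_div_mul_eq_div]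
      calc _ ≤ (2 ^ n * R + 2 ^ n * R) / n := by gcongr <;> exact hR _
        _ = _ := by ring
    calc _ ≤ ∫ _w, (2 : ℝ) ^ n * (2 * R / n) ∂π2 :=
          integral_mono (integrable_finsetSum _ fun σ _ => hswi σ) (integrable_const _) this
      _ = _ := by simp
  exact hstep.trans (le_of_mul_le_mul_left hfin (by positivity))

end uniformDeviation

/-! ### From rational half-lines to intervals and monotone weights. -/

/-- The difference between the empirical mean and the expectation of `G`. -/
noncomputable def empiricalError {Z : Type*} [MeasurableSpace Z] (P : Measure Z) {n : ℕ}
    (z : Fin n → Z) (G : Z → ℝ) : ℝ :=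
  (1 / (n : ℝ)) * ∑ i, G (z i) - ∫ x, G x ∂P

/-- Every lower set of the line is a pointwise limit of rational half-lines. -/
lemma IsLowerSet.exists_seq_rat_eventually_le_iff {L : Set ℝ} (hL : IsLowerSet L) :
    ∃ q : ℕ → ℚ, ∀ x : ℝ, ∀ᶠ k in Filter.atTop, (x ≤ q k ↔ x ∈ L) := by
  rcases L.eq_empty_or_nonempty with rfl | hne
  · refine ⟨fun k => -k, fun x => ?_⟩
    filter_upwards [tendsto_natCast_atTop_atTop.eventually_gt_atTop (-x)] with k hk
    simp only [Rat.cast_neg, Rat.cast_natCast, Set.mem_empty_iff_false, iff_false, not_le]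
    linarith
  by_cases hb : BddAbove L
  swap
  · refine ⟨fun k => k, fun x => ?_⟩
    filter_upwards [tendsto_natCast_atTop_atTop.eventually_ge_atTop x] with k hk
    obtain ⟨y, hy, hxy⟩ := not_bddAbove_iff.1 hb x
    simpa [hk] using hL hxy.le hy
  have hlt : ∀ x, x < sSup L → x ∈ L := fun x hx => by
    obtain ⟨y, hy, hxy⟩ := exists_lt_of_lt_csSup hne hx
    exact hL hxy.le hy
  have hpos : ∀ k : ℕ, (0 : ℝ) < 1 / ((k : ℝ) + 1) := fun k => by positivity
  have hlim : ∀ {y : ℝ}, 0 < y → ∀ᶠ k : ℕ in Filter.atTop, 1 / ((k : ℝ) + 1) < y := fun hy =>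
    tendsto_one_div_add_atTop_nhds_zero_nat.eventually_lt_const hy
  by_cases hs : sSup L ∈ L
  -- An attained supremum must be approached strictly from above, an unattained one strictly from
  -- below; otherwise the endpoint would be misclassified.
  · choose q hq1 hq2 using fun k : ℕ =>
      exists_rat_btwn (lt_add_of_pos_right (sSup L) (hpos k))
    refine ⟨q, fun x => ?_⟩
    rcases le_or_gt x (sSup L) with hx | hx
    · exact Filter.Eventually.of_forall fun k =>
        iff_of_true (hx.trans (hq1 k).le) (hL hx hs)
    · filter_upwards [hlim (sub_pos.2 hx)] with k hk
      refine iff_of_false (by linarith [hq2 k]) fun hxL => ?_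
      exact absurd (le_csSup hb hxL) hx.not_ge
  · choose q hq1 hq2 using fun k : ℕ =>
      exists_rat_btwn (sub_lt_self (sSup L) (hpos k))
    refine ⟨q, fun x => ?_⟩
    rcases lt_or_ge x (sSup L) with hx | hx
    · filter_upwards [hlim (sub_pos.2 hx)] with k hk
      exact iff_of_true (by linarith [hq1 k]) (hlt x hx)
    · refine Filter.Eventually.of_forall fun k => iff_of_false (by linarith [hq2 k]) fun hxL => ?_
      exact hs (le_antisymm (le_csSup hb hxL) hx ▸ hxL)

section empiricalError

variable {Z : Type*} [MeasurableSpace Z] {P : Measure Z} {n : ℕ} {z : Fin n → Z}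

lemma empiricalError_sub {G H : Z → ℝ} (hG : Integrable G P) (hH : Integrable H P) :
    empiricalError P z (fun x => G x - H x) = empiricalError P z G - empiricalError P z H := by
  simp only [empiricalError, Finset.sum_sub_distrib, integral_sub hG hH]
  ring

lemma empiricalError_const_mul_sum {ι : Type*} (s : Finset ι) {G : ι → Z → ℝ} (c : ℝ)
    (hG : ∀ i ∈ s, Integrable (G i) P) :
    empiricalError P z (fun x => c * ∑ i ∈ s, G i x) = c * ∑ i ∈ s, empiricalError P z (G i) := by
  simp only [empiricalError, integral_const_mul, integral_finsetSum s hG, Finset.sum_sub_distrib]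
  rw [← Finset.mul_sum, Finset.sum_comm, ← Finset.mul_sum]
  ring

variable [IsProbabilityMeasure P]

lemma abs_empiricalError_le {G : Z → ℝ} {η : ℝ} (hη : 0 ≤ η) (hG : ∀ x, |G x| ≤ η) :
    |empiricalError P z G| ≤ 2 * η := by
  have h1 : |∫ x, G x ∂P| ≤ η := by
    simpa using norm_integral_le_of_norm_le_const (μ := P) (f := G) (ae_of_all _ hG)
  have h2 : |(1 / (n : ℝ)) * ∑ i, G (z i)| ≤ η := by
    rw [abs_mul, abs_of_nonneg (by positivity : (0 : ℝ) ≤ 1 / n), one_div_mul_eq_div]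
    refine div_le_of_le_mul₀ n.cast_nonneg hη ((Finset.abs_sum_le_sum_abs _ _).trans ?_)
    calc _ ≤ ∑ _i : Fin n, η := Finset.sum_le_sum fun i _ => hG _
      _ = η * n := by simp [mul_comm]
  exact (abs_sub _ _).trans (by linarith)

variable {f w : Z → ℝ}

lemma integrable_mul_indicator_comp (hf : Measurable f) (hw : Measurable w)
    (hw01 : ∀ x, w x ∈ Set.Icc (0 : ℝ) 1) {J : Set ℝ} (hJ : J.OrdConnected) :
    Integrable (fun x => w x * J.indicator (fun _ => (1 : ℝ)) (f x)) P := by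
  refine Integrable.of_bound (C := 1) ?_ (ae_of_all _ fun x => ?_)
  · exact (hw.mul ((measurable_const.indicator hJ.measurableSet).comp hf)).aestronglyMeasurable
  · rw [Real.norm_eq_abs, abs_of_nonneg (mul_nonneg (hw01 x).1
      (Set.indicator_nonneg (fun _ _ => zero_le_one) _))]
    exact mul_le_one₀ (hw01 x).2 (Set.indicator_nonneg (fun _ _ => zero_le_one) _)
      (Set.indicator_le_self' (fun _ _ => zero_le_one) _)

/-- Restricting to rational endpoints keeps the class countable, hence the supremum measurable.
Nothing is lost: rational half-lines converge pointwise to `L`, and dominated convergence carries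
the bound over. -/
lemma abs_empiricalError_lowerSet_le (hf : Measurable f) (hw : Measurable w)
    (hw01 : ∀ x, w x ∈ Set.Icc (0 : ℝ) 1) {A : ℝ}
    (hA : ∀ q : ℚ, |empiricalError P z
      (fun x => w x * (Set.Iic (q : ℝ)).indicator (fun _ => (1 : ℝ)) (f x))| ≤ A)
    {L : Set ℝ} (hL : IsLowerSet L) :
    |empiricalError P z (fun x => w x * L.indicator (fun _ => (1 : ℝ)) (f x))| ≤ A := by
  obtain ⟨q, hq⟩ := hL.exists_seq_rat_eventually_le_iff
  have hlim : ∀ x, Filter.Tendsto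
      (fun k => w x * (Set.Iic (q k : ℝ)).indicator (fun _ => (1 : ℝ)) (f x)) Filter.atTop
      (nhds (w x * L.indicator (fun _ => (1 : ℝ)) (f x))) := fun x => by
    refine tendsto_const_nhds.congr' ?_
    filter_upwards [hq (f x)] with k hk
    by_cases hx : f x ∈ L
    · rw [Set.indicator_of_mem hx, Set.indicator_of_mem (Set.mem_Iic.2 (hk.2 hx))]
    · rw [Set.indicator_of_notMem hx, Set.indicator_of_notMem (s := Set.Iic _) fun h => hx (hk.1 h)]
  have hint := tendsto_integral_of_dominated_convergence (μ := P) (fun _ => (1 : ℝ))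
    (fun k => (integrable_mul_indicator_comp (P := P) hf hw hw01
      (Set.ordConnected_Iic (a := (q k : ℝ)))).aestronglyMeasurable) (integrable_const _)
    (fun k => ae_of_all _ fun x => by
      rw [Real.norm_eq_abs, abs_of_nonneg (mul_nonneg (hw01 x).1
        (Set.indicator_nonneg (fun _ _ => zero_le_one) _))]
      exact mul_le_one₀ (hw01 x).2 (Set.indicator_nonneg (fun _ _ => zero_le_one) _)
        (Set.indicator_le_self' (fun _ _ => zero_le_one) _))
    (ae_of_all _ hlim)
  exact le_of_tendsto (((tendsto_finsetSum _ fun i _ => hlim (z i)).const_mul _).sub hint).abs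
    (Filter.Eventually.of_forall fun k => hA (q k))

lemma abs_empiricalError_ordConnected_le (hf : Measurable f) (hw : Measurable w)
    (hw01 : ∀ x, w x ∈ Set.Icc (0 : ℝ) 1) {A : ℝ}
    (hA : ∀ q : ℚ, |empiricalError P z
      (fun x => w x * (Set.Iic (q : ℝ)).indicator (fun _ => (1 : ℝ)) (f x))| ≤ A)
    {J : Set ℝ} (hJ : J.OrdConnected) :
    |empiricalError P z (fun x => w x * J.indicator (fun _ => (1 : ℝ)) (f x))| ≤ 2 * A := by
  -- With `L` the lower closure of `J`, convexity of `J` makes `L \ J` a lower set too, so `1_J` is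
  -- a difference of two lower-set indicators.
  obtain ⟨L, hL, hJL, hLJ⟩ : ∃ L : Set ℝ, IsLowerSet L ∧ J ⊆ L ∧ ∀ a ∈ L, ∃ c ∈ J, a ≤ c :=
    ⟨_, (lowerClosure J).lower, subset_lowerClosure, fun _ ha => mem_lowerClosure.1 ha⟩
  have hL' : IsLowerSet (L \ J) := by
    rintro a b hba ⟨haL, haJ⟩
    refine ⟨hL hba haL, fun hbJ => haJ ?_⟩
    obtain ⟨c, hc, hac⟩ := hLJ a haL
    exact hJ.out hbJ hc ⟨hba, hac⟩
  have heq : (fun x => w x * J.indicator (fun _ => (1 : ℝ)) (f x)) = fun x =>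
      w x * L.indicator (fun _ => (1 : ℝ)) (f x) -
        w x * (L \ J).indicator (fun _ => (1 : ℝ)) (f x) := by
    ext x
    by_cases h1 : f x ∈ J
    · simp [h1, hJL h1]
    · by_cases h2 : f x ∈ L <;> simp [h1, h2]
  rw [heq, empiricalError_sub (integrable_mul_indicator_comp hf hw hw01 hL.ordConnected)
    (integrable_mul_indicator_comp hf hw hw01 hL'.ordConnected)]
  refine (abs_sub _ _).trans ?_
  linarith [abs_empiricalError_lowerSet_le hf hw hw01 hA hL,
    abs_empiricalError_lowerSet_le hf hw hw01 hA hL']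

/-- Approximation of a number in `[0, 1]` by counting the multiples of `1 / m` below it. -/
lemma abs_sub_inv_mul_sum_indicator_le {m : ℕ} (hm : 0 < m) {u : ℝ} (hu : u ∈ Set.Icc (0 : ℝ) 1) :
    |u - 1 / (m : ℝ) * ∑ k ∈ Finset.range m,
      (Set.Ici (((k : ℝ) + 1) / m)).indicator (fun _ => (1 : ℝ)) u| ≤ 1 / m := by
  have hm' : (0 : ℝ) < m := by exact_mod_cast hm
  have hmu : 0 ≤ m * u := mul_nonneg hm'.le hu.1
  have hfl : ⌊(m : ℝ) * u⌋₊ ≤ m := by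
    have : (m : ℝ) * u ≤ m := mul_le_of_le_one_right hm'.le hu.2
    exact (Nat.floor_le_floor this).trans_eq (Nat.floor_natCast m)
  have hsum : ∑ k ∈ Finset.range m, (Set.Ici (((k : ℝ) + 1) / m)).indicator (fun _ => (1 : ℝ)) u =
      ⌊(m : ℝ) * u⌋₊ := by
    simp only [Set.indicator_apply, Set.mem_Ici]
    rw [Finset.sum_boole]
    congr 1
    have : (Finset.range m).filter (fun k : ℕ => ((k : ℝ) + 1) / m ≤ u) =
        Finset.range ⌊(m : ℝ) * u⌋₊ := by
      ext k
      have h1 : ((k : ℝ) + 1) / m ≤ u ↔ k < ⌊(m : ℝ) * u⌋₊ := by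
        rw [div_le_iff₀' hm', ← Nat.succ_le_iff, Nat.le_floor_iff hmu]
        push_cast
        rfl
      simp only [Finset.mem_filter, Finset.mem_range, h1]
      omega
    rw [this, Finset.card_range]
  rw [hsum]
  have h1 := Nat.floor_le hmu
  have h2 := Nat.lt_floor_add_one ((m : ℝ) * u)
  have : u - 1 / (m : ℝ) * ⌊(m : ℝ) * u⌋₊ = 1 / m * (m * u - ⌊(m : ℝ) * u⌋₊) := by
    field_simp
  rw [this, abs_mul, abs_of_nonneg (by positivity : (0 : ℝ) ≤ 1 / m)]
  refine mul_le_of_le_one_right (by positivity) (abs_le.2 ⟨by linarith, by linarith⟩)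

/-- Layer cake: the superlevel sets of `h` within `J` are intervals, and averaging their indicators
does not increase the bound `2 * B`. Discretizing the levels costs a vanishing error. -/
lemma abs_empiricalError_monotone_comp_le (hf : Measurable f) {B : ℝ}
    (hB : ∀ q : ℚ, |empiricalError P z
      (fun x => 1 * (Set.Iic (q : ℝ)).indicator (fun _ => (1 : ℝ)) (f x))| ≤ B)
    {h : ℝ → ℝ} (hh : Monotone h ∨ Antitone h) (h01 : ∀ s, h s ∈ Set.Icc (0 : ℝ) 1)
    {J : Set ℝ} (hJ : J.OrdConnected) :
    |empiricalError P z (fun x => h (f x) * J.indicator (fun _ => (1 : ℝ)) (f x))| ≤ 2 * B := by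
  have hhm : Measurable h := hh.elim Monotone.measurable Antitone.measurable
  have hord : ∀ c, (h ⁻¹' Set.Ici c ∩ J).OrdConnected := fun c =>
    Set.OrdConnected.inter (hh.elim
      (fun hm => Set.OrdConnected.preimage_mono Set.ordConnected_Ici hm)
      (fun hm => Set.OrdConnected.preimage_anti Set.ordConnected_Ici hm)) hJ
  have h1m : Measurable fun _ : Z => (1 : ℝ) := measurable_const
  have h101 : ∀ _ : Z, (1 : ℝ) ∈ Set.Icc (0 : ℝ) 1 := fun _ => ⟨zero_le_one, le_rfl⟩
  have key : ∀ m : ℕ, |empiricalError P z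
      (fun x => h (f x) * J.indicator (fun _ => (1 : ℝ)) (f x))| ≤
        2 * B + 2 * (1 / ((m : ℝ) + 1)) := by
    intro m
    set G : Z → ℝ := fun x => 1 / ((m + 1 : ℕ) : ℝ) * ∑ k ∈ Finset.range (m + 1),
      1 * (h ⁻¹' Set.Ici (((k : ℝ) + 1) / (m + 1 : ℕ)) ∩ J).indicator (fun _ => (1 : ℝ)) (f x)
    have hGi : Integrable G P := (integrable_finsetSum _ fun k _ =>
      integrable_mul_indicator_comp hf h1m h101 (hord _)).const_mul _
    have hhi : Integrable (fun x => h (f x) * J.indicator (fun _ => (1 : ℝ)) (f x)) P :=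
      integrable_mul_indicator_comp hf (hhm.comp hf) (fun x => h01 _) hJ
    have hGerr : |empiricalError P z G| ≤ 2 * B := by
      rw [empiricalError_const_mul_sum _ _ fun k _ =>
        integrable_mul_indicator_comp hf h1m h101 (hord _), abs_mul,
        abs_of_nonneg (by positivity : (0 : ℝ) ≤ 1 / ((m + 1 : ℕ) : ℝ)), one_div_mul_eq_div,
        div_le_iff₀ (by positivity)]
      refine (Finset.abs_sum_le_sum_abs _ _).trans ?_
      calc _ ≤ ∑ _k ∈ Finset.range (m + 1), 2 * B := Finset.sum_le_sum fun k _ =>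
            abs_empiricalError_ordConnected_le hf h1m h101 hB (hord _)
        _ = _ := by simp [mul_comm]
    have hdiff : |empiricalError P z
        (fun x => h (f x) * J.indicator (fun _ => (1 : ℝ)) (f x) - G x)| ≤
          2 * (1 / ((m : ℝ) + 1)) := by
      refine abs_empiricalError_le (by positivity) fun x => ?_
      by_cases hx : f x ∈ J
      · have hGx : G x = 1 / ((m + 1 : ℕ) : ℝ) * ∑ k ∈ Finset.range (m + 1),
            (Set.Ici (((k : ℝ) + 1) / (m + 1 : ℕ))).indicator (fun _ => (1 : ℝ)) (h (f x)) := by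
          refine congrArg _ (Finset.sum_congr rfl fun k _ => ?_)
          rw [one_mul]
          by_cases hc : h (f x) ∈ Set.Ici (((k : ℝ) + 1) / (m + 1 : ℕ))
          · rw [Set.indicator_of_mem hc, Set.indicator_of_mem (s := _ ∩ J) (a := f x) ⟨hc, hx⟩]
          · rw [Set.indicator_of_notMem hc, Set.indicator_of_notMem fun h' => hc h'.1]
        have := abs_sub_inv_mul_sum_indicator_le (Nat.succ_pos m) (h01 (f x))
        rw [hGx, Set.indicator_of_mem hx, mul_one]
        exact_mod_cast this
      · have hGx : G x = 0 := by
          refine mul_eq_zero_of_right _ (Finset.sum_eq_zero fun k _ => ?_)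
          rw [Set.indicator_of_notMem fun h' => hx h'.2, mul_zero]
        rw [hGx, Set.indicator_of_notMem hx, mul_zero, sub_zero, abs_zero]
        positivity
    rw [empiricalError_sub hhi hGi] at hdiff
    have := abs_sub_abs_le_abs_sub (empiricalError P z
      (fun x => h (f x) * J.indicator (fun _ => (1 : ℝ)) (f x))) (empiricalError P z G)
    linarith
  have hlim := (tendsto_one_div_add_atTop_nhds_zero_nat (𝕜 := ℝ)).const_mul 2 |>.const_add (2 * B)
  rw [mul_zero, add_zero] at hlim
  exact ge_of_tendsto' hlim key

end empiricalError

/-! ### Bounds on the cutoff calibration error. -/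

lemma le_empiricalCutoffError {𝒳 : Type*} {n : ℕ} {D : Fin n → 𝒳 × ℝ} (g : 𝒳 → ℝ) {I : Set ℝ} (hI : I.OrdConnected) :
    |(1 / (n : ℝ)) * ∑ i, ((D i).2 - g (D i).1) * I.indicator (fun _ => (1 : ℝ)) (g (D i).1)| ≤
      empiricalCutoffError D g := by
  refine le_ciSup (f := fun I : {I : Set ℝ // I.OrdConnected} => |(1 / (n : ℝ)) *
    ∑ i, ((D i).2 - g (D i).1) * I.1.indicator (fun _ => (1 : ℝ)) (g (D i).1)|) ?_ ⟨I, hI⟩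
  -- A real supremum of an unbounded family is 0 by convention, so boundedness must be shown.
  refine ⟨(1 / (n : ℝ)) * ∑ i, |(D i).2 - g (D i).1|, ?_⟩
  rintro _ ⟨J, rfl⟩
  dsimp only
  rw [abs_mul, abs_of_nonneg (by positivity : (0 : ℝ) ≤ 1 / n)]
  gcongr
  refine (Finset.abs_sum_le_sum_abs _ _).trans (Finset.sum_le_sum fun i _ => ?_)
  rw [abs_mul, abs_of_nonneg (Set.indicator_nonneg (fun _ _ => zero_le_one) _)]
  exact mul_le_of_le_one_right (abs_nonneg _)
    (Set.indicator_le_self' (fun _ _ => zero_le_one) _)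

section cutoffError

variable {𝒳 : Type*} [MeasurableSpace 𝒳] {P : Measure (𝒳 × ℝ)} [IsProbabilityMeasure P]
  {f : 𝒳 → ℝ} {n : ℕ} {D : Fin n → 𝒳 × ℝ} {w : 𝒳 × ℝ → ℝ}

/-- Pulling `I` back along `h` splits the gap into a `Y` part, at most `2 * A`, and an `h ∘ f` part,
at most `2 * B`. Neither bound depends on `h`, so `h` may depend on the data. -/
lemma cutoffError_comp_le (hf : Measurable f) (hw : Measurable w)
    (hw01 : ∀ p, w p ∈ Set.Icc (0 : ℝ) 1) (hwP : ∀ᵐ p ∂P, w p = p.2)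
    (hwD : ∀ i, w (D i) = (D i).2) {A B : ℝ}
    (hA : ∀ q : ℚ, |empiricalError P D
      (fun p => w p * (Set.Iic (q : ℝ)).indicator (fun _ => (1 : ℝ)) (f p.1))| ≤ A)
    (hB : ∀ q : ℚ, |empiricalError P D
      (fun p => 1 * (Set.Iic (q : ℝ)).indicator (fun _ => (1 : ℝ)) (f p.1))| ≤ B)
    {h : ℝ → ℝ} (hh : Monotone h ∨ Antitone h) (h01 : ∀ s, h s ∈ Set.Icc (0 : ℝ) 1) :
    cutoffError P (h ∘ f) ≤ empiricalCutoffError D (h ∘ f) + (2 * A + 2 * B) := by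
  have hhm : Measurable h := hh.elim Monotone.measurable Antitone.measurable
  have hf1 : Measurable fun p : 𝒳 × ℝ => f p.1 := hf.comp measurable_fst
  have : Nonempty {I : Set ℝ // I.OrdConnected} := ⟨⟨_, Set.ordConnected_univ⟩⟩
  refine ciSup_le fun I => ?_
  have hJ : (h ⁻¹' I.1).OrdConnected := hh.elim
    (fun hm => Set.OrdConnected.preimage_mono I.2 hm)
    (fun hm => Set.OrdConnected.preimage_anti I.2 hm)
  have h1 := abs_empiricalError_ordConnected_le hf1 hw hw01 hA hJ
  have h2 := abs_empiricalError_monotone_comp_le hf1 hB hh h01 hJ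
  have hsub := empiricalError_sub (z := D)
    (integrable_mul_indicator_comp (P := P) hf1 hw hw01 hJ)
    (integrable_mul_indicator_comp (P := P) hf1 (hhm.comp hf1) (fun p => h01 _) hJ)
  have hint : ∫ p, (w p * (h ⁻¹' I.1).indicator (fun _ => (1 : ℝ)) (f p.1) -
      h (f p.1) * (h ⁻¹' I.1).indicator (fun _ => (1 : ℝ)) (f p.1)) ∂P =
      ∫ p, (p.2 - (h ∘ f) p.1) * I.1.indicator (fun _ => (1 : ℝ)) ((h ∘ f) p.1) ∂P := by
    refine integral_congr_ae ?_
    filter_upwards [hwP] with p hp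
    rw [hp, ← sub_mul]
    rfl
  have hsum : ∑ i, (w (D i) * (h ⁻¹' I.1).indicator (fun _ => (1 : ℝ)) (f (D i).1) -
      h (f (D i).1) * (h ⁻¹' I.1).indicator (fun _ => (1 : ℝ)) (f (D i).1)) =
      ∑ i, ((D i).2 - (h ∘ f) (D i).1) *
        I.1.indicator (fun _ => (1 : ℝ)) ((h ∘ f) (D i).1) := by
    refine Finset.sum_congr rfl fun i _ => ?_
    rw [hwD, ← sub_mul]
    rfl
  have h3 := le_empiricalCutoffError (D := D) (h ∘ f) I.2
  rw [empiricalError] at hsub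
  simp only [Function.comp_def] at hsub hint hsum h3 ⊢
  rw [hint, hsum] at hsub
  rw [abs_le] at h1 h2 h3 ⊢
  constructor <;> linarith [h1.1, h1.2, h2.1, h2.2, h3.1, h3.2]

/-- For a constant forecast the indicator is identically 0 or 1, so only the deviation of the mean
of `Y` remains: the case `J = univ`. -/
lemma cutoffError_const_mean_le (hf : Measurable f) (hw : Measurable w)
    (hw01 : ∀ p, w p ∈ Set.Icc (0 : ℝ) 1) (hwP : ∀ᵐ p ∂P, w p = p.2)
    (hwD : ∀ i, w (D i) = (D i).2) {A : ℝ}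
    (hA : ∀ q : ℚ, |empiricalError P D
      (fun p => w p * (Set.Iic (q : ℝ)).indicator (fun _ => (1 : ℝ)) (f p.1))| ≤ A) :
    cutoffError P (fun _ => (1 / (n : ℝ)) * ∑ i, (D i).2) ≤ 2 * A := by
  have hf1 : Measurable fun p : 𝒳 × ℝ => f p.1 := hf.comp measurable_fst
  have h1 := abs_empiricalError_ordConnected_le hf1 hw hw01 hA Set.ordConnected_univ
  simp only [Set.indicator_univ, mul_one, empiricalError, hwD] at h1
  rw [integral_congr_ae hwP] at h1
  have hi : Integrable (fun p : 𝒳 × ℝ => p.2) P :=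
    (Integrable.of_bound hw.aestronglyMeasurable 1 (ae_of_all _ fun p =>
      (abs_of_nonneg (hw01 p).1).trans_le (hw01 p).2)).congr hwP
  have : Nonempty {I : Set ℝ // I.OrdConnected} := ⟨⟨_, Set.ordConnected_univ⟩⟩
  refine ciSup_le fun I => ?_
  rw [integral_mul_const, abs_mul, integral_sub hi (integrable_const _), integral_const,
    probReal_univ, one_smul, abs_sub_comm,
    abs_of_nonneg (Set.indicator_nonneg (fun _ _ => zero_le_one) _)]
  exact (mul_le_of_le_one_right (abs_nonneg _)
    (Set.indicator_le_self' (fun _ _ => zero_le_one) _)).trans h1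

end cutoffError

lemma IsPlattFit.monotone_or_antitone {n : ℕ} {z y : Fin n → ℝ} {h : ℝ → ℝ}
    (hh : IsPlattFit z y h) : (Monotone h ∨ Antitone h) ∧ ∀ s, h s ∈ Set.Icc (0 : ℝ) 1 := by
  obtain ⟨a, b, rfl⟩ : ∃ a b : ℝ, h = fun s => Real.sigmoid (a * s + b) := by
    rcases hh with ⟨a, b, -, h⟩ | ⟨a, b, -, h⟩ <;> exact ⟨a, b, h⟩
  refine ⟨?_, fun s => ⟨Real.sigmoid_nonneg _, Real.sigmoid_le_one _⟩⟩
  rcases le_total 0 a with ha | ha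
  · exact Or.inl fun s t hst => Real.sigmoid_monotone
      (add_le_add_left (mul_le_mul_of_nonneg_left hst ha) b)
  · exact Or.inr fun s t hst => Real.sigmoid_monotone
      (add_le_add_left (mul_le_mul_of_nonpos_left hst ha) b)

/-! ### Concentration and conclusion. -/

/-- Uniform deviations of half-lines weighted by `w` and of unweighted half-lines are jointly
small with high probability. -/
lemma measureReal_pi_uniformDeviation_halfLine_le {Z : Type*} [MeasurableSpace Z]
    (P : Measure Z) [IsProbabilityMeasure P] {f w : Z → ℝ} (hf : Measurable f) (hw : Measurable w)
    (hw01 : ∀ x, w x ∈ Set.Icc (0 : ℝ) 1) {n : ℕ} (hn : 0 < n) {s : ℝ} (hs : 0 ≤ s) :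
    (Measure.pi fun _ : Fin n => P).real {z | 15 / √(n : ℝ) + s ≤
      uniformDeviation P (fun (q : ℚ) x =>
        w x * (Set.Iic (q : ℝ)).indicator (fun _ => (1 : ℝ)) (f x)) z +
      uniformDeviation P (fun (q : ℚ) x =>
        1 * (Set.Iic (q : ℝ)).indicator (fun _ => (1 : ℝ)) (f x)) z} ≤
      Real.exp (-(n * s ^ 2 / 2)) := by
  have hn' : (0 : ℝ) < n := by exact_mod_cast hn
  have hmeas : ∀ {v : Z → ℝ}, Measurable v → ∀ q : ℚ, Measurable fun x =>
      v x * (Set.Iic (q : ℝ)).indicator (fun _ => (1 : ℝ)) (f x) := fun hv q =>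
    hv.mul ((measurable_const.indicator measurableSet_Iic).comp hf)
  have hmem : ∀ {v : Z → ℝ}, (∀ x, v x ∈ Set.Icc (0 : ℝ) 1) → ∀ (q : ℚ) x,
      v x * (Set.Iic (q : ℝ)).indicator (fun _ => (1 : ℝ)) (f x) ∈ Set.Icc (0 : ℝ) 1 :=
    fun hv q x => ⟨mul_nonneg (hv x).1 (Set.indicator_nonneg (fun _ _ => zero_le_one) _),
      mul_le_one₀ (hv x).2 (Set.indicator_nonneg (fun _ _ => zero_le_one) _)
        (Set.indicator_le_self' (fun _ _ => zero_le_one) _)⟩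
  have hexp : ∀ {v : Z → ℝ}, Measurable v → (∀ x, v x ∈ Set.Icc (0 : ℝ) 1) →
      ∫ z, uniformDeviation P (fun (q : ℚ) x =>
        v x * (Set.Iic (q : ℝ)).indicator (fun _ => (1 : ℝ)) (f x)) z
          ∂(Measure.pi fun _ : Fin n => P) ≤ 2 * √(8 * n) / n := fun {v} hv hv01 =>
    integral_uniformDeviation_le (hmeas hv) (hmem hv01) hn fun z =>
      sum_iSup_rademacher_halfLine_le (fun q : ℚ => (q : ℝ)) (fun i => f (z i)) (fun i => v (z i))
        fun i => (abs_of_nonneg (hv01 _).1).trans_le (hv01 _).2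
  have h1m : Measurable fun _ : Z => (1 : ℝ) := measurable_const
  have h101 : ∀ _ : Z, (1 : ℝ) ∈ Set.Icc (0 : ℝ) 1 := fun _ => ⟨zero_le_one, le_rfl⟩
  set U : (Fin n → Z) → ℝ := uniformDeviation P (fun (q : ℚ) x =>
    w x * (Set.Iic (q : ℝ)).indicator (fun _ => (1 : ℝ)) (f x)) with hU
  set V : (Fin n → Z) → ℝ := uniformDeviation P (fun (q : ℚ) x =>
    1 * (Set.Iic (q : ℝ)).indicator (fun _ => (1 : ℝ)) (f x)) with hV
  have hUm : Measurable U := measurable_uniformDeviation (hmeas hw)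
  have hVm : Measurable V := measurable_uniformDeviation (hmeas h1m)
  have hU1 : ∀ z, |U z| ≤ 1 := fun z => by
    rw [abs_of_nonneg (uniformDeviation_nonneg z)]
    exact uniformDeviation_le_one (hmeas hw) (hmem hw01) z
  have hV1 : ∀ z, |V z| ≤ 1 := fun z => by
    rw [abs_of_nonneg (uniformDeviation_nonneg z)]
    exact uniformDeviation_le_one (hmeas h1m) (hmem h101) z
  have hUi : Integrable U (Measure.pi fun _ : Fin n => P) :=
    Integrable.of_bound hUm.aestronglyMeasurable 1 (ae_of_all _ hU1)
  have hVi : Integrable V (Measure.pi fun _ : Fin n => P) :=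
    Integrable.of_bound hVm.aestronglyMeasurable 1 (ae_of_all _ hV1)
  have hmean : ∫ z, (U z + V z) ∂(Measure.pi fun _ : Fin n => P) ≤ 15 / √(n : ℝ) := by
    rw [integral_add hUi hVi]
    refine (add_le_add (hexp hw hw01) (hexp h1m h101)).trans ?_
    -- Each class contributes `2√8 / √n`, so what is needed is `4√8 ≤ 15`.
    have h8 : √(8 : ℝ) ≤ 15 / 4 := Real.sqrt_le_iff.2 ⟨by norm_num, by norm_num⟩
    have hsq : √(n : ℝ) ^ 2 = n := Real.sq_sqrt hn'.le
    have hs0 : 0 < √(n : ℝ) := Real.sqrt_pos.2 hn'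
    have : 2 * √(8 * n) / n = 2 * √8 / √(n : ℝ) := by
      rw [Real.sqrt_mul (by norm_num), div_eq_div_iff hn'.ne' hs0.ne']
      linear_combination 2 * √8 * hsq
    rw [this, ← add_div]
    gcongr
    linarith
  -- Replacing one data point moves each of `U` and `V` by at most `1 / n`, hence `c = 2 / n`.
  have hmc := measureReal_pi_ge_le_of_bounded_differences P (c := 2 / n) (by positivity) hn
    (fun z => U z + V z) (hUm.add hVm) (C := 2)
    (fun z => (abs_add_le _ _).trans (by linarith [hU1 z, hV1 z]))
    (fun z i v => by
      have h1 := uniformDeviation_update_sub_le (P := P) (hmeas hw) (hmem hw01) z i v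
      have h2 := uniformDeviation_update_sub_le (P := P) (hmeas h1m) (hmem h101) z i v
      have h3 : (2 : ℝ) / n = 1 / n + 1 / n := by ring
      rw [h3]
      linarith) hs
  refine (measureReal_mono fun z hz => ?_).trans (hmc.trans_eq ?_)
  · exact (add_le_add_left hmean s).trans hz
  · congr 2
    field_simp

theorem propositionD3 {Ω 𝒳 : Type*} [MeasurableSpace Ω] [MeasurableSpace 𝒳]
    (μ : Measure Ω) [IsProbabilityMeasure μ]
    (P : Measure (𝒳 × ℝ)) [IsProbabilityMeasure P]
    (hP : ∀ᵐ p ∂P, p.2 ∈ Set.Icc (0 : ℝ) 1)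
    (f : 𝒳 → ℝ) (hf : Measurable f) (hf01 : ∀ x, f x ∈ Set.Icc (0 : ℝ) 1)
    (n : ℕ) (hn : 1 ≤ n)
    (X : Fin n → Ω → 𝒳) (Y : Fin n → Ω → ℝ)
    (hX : ∀ i, Measurable (X i)) (hY : ∀ i, Measurable (Y i))
    (hindep : iIndepFun (fun i ω => (X i ω, Y i ω)) μ)
    (hlaw : ∀ i, μ.map (fun ω => (X i ω, Y i ω)) = P)
    (δ : ℝ) (hδ : 0 < δ) (ε : ℝ) (hε : 0 < ε)
    (hTilde : Ω → ℝ → ℝ)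
    (hPlatt : ∀ᵐ ω ∂μ, IsPlattFit (fun i => f (X i ω)) (fun i => Y i ω) (hTilde ω)) :
    ∃ E : Set Ω, MeasurableSet E ∧ 1 - δ ≤ μ.real E ∧
      ∀ ω ∈ E,
        cutoffError P (modifiedPlatt (fun i => (X i ω, Y i ω)) f ε (hTilde ω) ∘ f) ≤
          (30 + 2 * √(2 * Real.log (2 / δ))) / √(n : ℝ) + ε := by
  -- For `δ ≥ 1` the empty event suffices; afterwards `log (2 / δ)` is positive.
  rcases le_or_gt 1 δ with h1δ | hδ1
  · exact ⟨∅, MeasurableSet.empty, by simpa using h1δ, by simp⟩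
  have hn' : (0 : ℝ) < n := by exact_mod_cast hn
  have hsn : 0 < √(n : ℝ) := Real.sqrt_pos.2 hn'
  -- Clipping `Y` makes the weight lie in `[0, 1]` everywhere, not just almost surely; it changes
  -- neither the integrals nor, almost surely, the sample.
  set w : 𝒳 × ℝ → ℝ := fun p => max 0 (min p.2 1) with hw_def
  have hw : Measurable w := by fun_prop
  have hw01 : ∀ p, w p ∈ Set.Icc (0 : ℝ) 1 := fun p =>
    ⟨le_max_left _ _, max_le zero_le_one (min_le_right _ _)⟩
  have hw_eq : ∀ p : 𝒳 × ℝ, p.2 ∈ Set.Icc (0 : ℝ) 1 → w p = p.2 := fun p hp => by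
    simp [hw_def, hp.1, hp.2]
  have hwP : ∀ᵐ p ∂P, w p = p.2 := hP.mono hw_eq
  have hf1 : Measurable fun p : 𝒳 × ℝ => f p.1 := hf.comp measurable_fst
  set s : ℝ := √(2 * Real.log (2 / δ)) / √(n : ℝ) with hs_def
  have hs : 0 ≤ s := by positivity
  have hlog : 0 ≤ 2 * Real.log (2 / δ) :=
    mul_nonneg zero_le_two (Real.log_nonneg ((one_le_div hδ).2 (by linarith)))
  -- The left side is exactly `δ / 2`.
  have hexp : Real.exp (-(n * s ^ 2 / 2)) ≤ δ := by
    have : (n : ℝ) * s ^ 2 / 2 = Real.log (2 / δ) := by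
      rw [hs_def, div_pow, Real.sq_sqrt hlog, Real.sq_sqrt hn'.le]
      field_simp
    rw [this, Real.exp_neg, Real.exp_log (by positivity), inv_div]
    linarith
  set φ : ℚ → 𝒳 × ℝ → ℝ := fun q p =>
    w p * (Set.Iic (q : ℝ)).indicator (fun _ => (1 : ℝ)) (f p.1) with hφ
  set ψ : ℚ → 𝒳 × ℝ → ℝ := fun q p =>
    1 * (Set.Iic (q : ℝ)).indicator (fun _ => (1 : ℝ)) (f p.1) with hψ
  have hind01 : ∀ (q : ℚ) (p : 𝒳 × ℝ),
      (Set.Iic (q : ℝ)).indicator (fun _ => (1 : ℝ)) (f p.1) ∈ Set.Icc (0 : ℝ) 1 := fun q p =>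
    ⟨Set.indicator_nonneg (fun _ _ => zero_le_one) _,
      Set.indicator_le_self' (fun _ _ => zero_le_one) _⟩
  have hindm : ∀ q : ℚ, Measurable fun p : 𝒳 × ℝ =>
      (Set.Iic (q : ℝ)).indicator (fun _ => (1 : ℝ)) (f p.1) := fun q =>
    (measurable_const.indicator measurableSet_Iic).comp hf1
  have hφm : ∀ q, Measurable (φ q) := fun q => hw.mul (hindm q)
  have hψm : ∀ q, Measurable (ψ q) := fun q => measurable_const.mul (hindm q)
  have hφ01 : ∀ q p, φ q p ∈ Set.Icc (0 : ℝ) 1 := fun q p =>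
    ⟨mul_nonneg (hw01 p).1 (hind01 q p).1,
      mul_le_one₀ (hw01 p).2 (hind01 q p).1 (hind01 q p).2⟩
  have hψ01 : ∀ q p, ψ q p ∈ Set.Icc (0 : ℝ) 1 := fun q p => by
    simpa only [hψ, one_mul] using hind01 q p
  set F : (Fin n → 𝒳 × ℝ) → ℝ := fun z => uniformDeviation P φ z + uniformDeviation P ψ z
  have hFm : Measurable F :=
    (measurable_uniformDeviation hφm).add (measurable_uniformDeviation hψm)
  set B : Set (Fin n → 𝒳 × ℝ) := {z | 15 / √(n : ℝ) + s ≤ F z}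
  have hBm : MeasurableSet B := measurableSet_le measurable_const hFm
  have hB : (Measure.pi fun _ : Fin n => P).real B ≤ δ :=
    (measureReal_pi_uniformDeviation_halfLine_le P hf1 hw hw01 hn hs).trans hexp
  set Φ : Ω → Fin n → 𝒳 × ℝ := fun ω i => (X i ω, Y i ω)
  have hZm : ∀ i, Measurable fun ω => (X i ω, Y i ω) := fun i => (hX i).prodMk (hY i)
  have hΦm : Measurable Φ := measurable_pi_lambda _ hZm
  have hΦ : μ.map Φ = Measure.pi fun _ : Fin n => P := by
    have := (iIndepFun_iff_map_fun_eq_pi_map fun i => (hZm i).aemeasurable).1 hindep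
    simpa only [hlaw] using this
  have hΦB : μ.real (Φ ⁻¹' B) ≤ δ := by
    rw [← map_measureReal_apply hΦm hBm, hΦ]
    exact hB
  have hY01 : ∀ᵐ ω ∂μ, ∀ i, Y i ω ∈ Set.Icc (0 : ℝ) 1 := ae_all_iff.2 fun i => by
    have h := hP
    rw [← hlaw i] at h
    exact ae_of_ae_map (hZm i).aemeasurable h
  -- The bad event `B` involves only the data, so measurability of the fit in `ω` is not needed: its
  -- exceptional set is enclosed in a measurable null set.
  obtain ⟨N, hNsub, hNm, hN0⟩ := exists_measurable_superset_of_null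
    (ae_iff.1 (hPlatt.and hY01))
  refine ⟨(Φ ⁻¹' B ∪ N)ᶜ, ((hΦm hBm).union hNm).compl, ?_, fun ω hω => ?_⟩
  · rw [probReal_compl_eq_one_sub ((hΦm hBm).union hNm)]
    have h1 := measureReal_union_le (μ := μ) (Φ ⁻¹' B) N
    have h2 : μ.real N = 0 := by simp [measureReal_def, hN0]
    linarith
  rw [Set.compl_union] at hω
  obtain ⟨hωP, hωY⟩ := not_not.1 fun h => hω.2 (hNsub h)
  have hFω : F (Φ ω) < 15 / √(n : ℝ) + s := not_le.1 hω.1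
  have hbound : (30 + 2 * √(2 * Real.log (2 / δ))) / √(n : ℝ) = 2 * (15 / √(n : ℝ) + s) := by
    rw [hs_def]
    ring
  have hU : ∀ q, |empiricalError P (Φ ω) (φ q)| ≤ uniformDeviation P φ (Φ ω) :=
    le_uniformDeviation hφm hφ01 (Φ ω)
  have hV : ∀ q, |empiricalError P (Φ ω) (ψ q)| ≤ uniformDeviation P ψ (Φ ω) :=
    le_uniformDeviation hψm hψ01 (Φ ω)
  have hwD : ∀ i, w (Φ ω i) = (Φ ω i).2 := fun i => hw_eq _ (hωY i)
  rw [hbound]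
  by_cases hcut : empiricalCutoffError (Φ ω) (hTilde ω ∘ f) ≤ ε
  · have hmod : modifiedPlatt (Φ ω) f ε (hTilde ω) = hTilde ω := by
      ext z
      exact if_pos hcut
    obtain ⟨hmono, h01⟩ := hωP.monotone_or_antitone
    have := cutoffError_comp_le hf hw hw01 hwP hwD hU hV hmono h01
    rw [hmod]
    linarith
  · have hmod : modifiedPlatt (Φ ω) f ε (hTilde ω) ∘ f =
        fun _ => (1 / (n : ℝ)) * ∑ i, (Φ ω i).2 := by
      ext z
      exact if_neg hcut
    have := cutoffError_const_mean_le hf hw hw01 hwP hwD hU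
    have hV0 := uniformDeviation_nonneg (P := P) (φ := ψ) (Φ ω)
    rw [hmod]
    linarith
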